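/- Conventions. Let $\tau$ be a relational signature, i.e. a set of relation symbols of finite arities. All structures are relational structures over $\tau$ and are countable, i.e. finite or countably infinite. For a structure $A$ and a subset $S$ of its domain, the \emph{orbit} of $S$ is $\{\alpha(S) \mid \alpha \in \mathrm{Aut}(A)\}$; if $|S| = n$, it is called an \emph{orbit of $n$-subsets} of $A$. The structure $A$ is \emph{$\omega$-categorical} if for every $n \in \mathbb{N}$ it has only finitely many orbits of $n$-subsets (finite structures are included). It is a \emph{core} if every endomorphism of $A$ is an embedding (i.e. an isomorphism onto an induced substructure), and \emph{model-complete} if every embedding of $A$ into itself preserves all first-order formulas. A \emph{model-complete core of $\Delta$} is a structure $\Gamma$ that is a core, is model-complete, and is homomorphically equivalent to $\Delta$, that is, there are homomorphisms $\Gamma \to \Delta$ and $\Delta \to \Gamma$. Proposition. Let $\Delta$ be an $\omega$-categorical structure and let $\Gamma$ be a model-complete core of $\Delta$. Then for every $n \in \mathbb{N}$, the number of orbits of $n$-subsets of $\Gamma$ is at most the number of orbits of $n$-subsets of $\Delta$. -/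

import Mathlib

open FirstOrder

universe u v w

/-- The orbit of a subset `S` of the domain under the automorphism group of the structure:
the set of all images `{α s | s ∈ S}`, where `α` ranges over the automorphisms. -/
def subsetOrbit (L : FirstOrder.Language.{u, v}) (M : Type w) [L.Structure M] (S : Set M) :
    Set (Set M) :=
  {T | ∃ α : M ≃[L] M, T = (fun x => α x) '' S}

/-- The set of all orbits of `n`-subsets of the structure `M`, i.e. of the orbits of those
subsets that have exactly `n` elements. -/
def nSubsetOrbits (L : FirstOrder.Language.{u, v}) (M : Type w) [L.Structure M] (n : ℕ) :
    Set (Set (Set M)) :=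
  {O | ∃ S : Set M, S.encard = (n : ℕ∞) ∧ O = subsetOrbit L M S}

/-- A structure is `ω`-categorical if it is countable (finite structures are allowed) and has,
for every `n`, only finitely many orbits of `n`-subsets. -/
def IsOmegaCategorical (L : FirstOrder.Language.{u, v}) (M : Type w) [L.Structure M] : Prop :=
  Countable M ∧ ∀ n : ℕ, (nSubsetOrbits L M n).Finite

/-- A structure is a core if each of its endomorphisms is an embedding. -/
def IsCoreStructure (L : FirstOrder.Language.{u, v}) (M : Type w) [L.Structure M] : Prop :=
  ∀ f : M →[L] M, ∃ e : M ↪[L] M, ∀ x : M, e x = f x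

/-- A structure is model-complete if each of its self-embeddings preserves all first-order
formulas. -/
def IsModelCompleteStructure (L : FirstOrder.Language.{u, v}) (M : Type w) [L.Structure M] :
    Prop :=
  ∀ (e : M ↪[L] M) (n : ℕ) (φ : L.Formula (Fin n)) (x : Fin n → M),
    φ.Realize x → φ.Realize (fun i => e (x i))

/-- Two structures are homomorphically equivalent if there are homomorphisms in both
directions. -/
def HomEquivalent (L : FirstOrder.Language.{u, v}) (M : Type w) (N : Type*) [L.Structure M]
    [L.Structure N] : Prop :=
  Nonempty (M →[L] N) ∧ Nonempty (N →[L] M)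

/-- `Γ` is a model-complete core of `Δ`: a countable (possibly finite) model-complete core
that is homomorphically equivalent to `Δ`. -/
structure IsModelCompleteCoreOf (L : FirstOrder.Language.{u, v}) (Γ : Type w) (Δ : Type*)
    [L.Structure Γ] [L.Structure Δ] : Prop where
  countable : Countable Γ
  isCore : IsCoreStructure L Γ
  isModelComplete : IsModelCompleteStructure L Γ
  homEquivalent : HomEquivalent L Γ Δ

/-!
Fix homomorphisms `g : Γ → Δ` and `h : Δ → Γ`. Since `Γ` is a model-complete core, its endomorphisms
are elementary, so that a tuple `a` of `Γ` has the same first-order type as `h (α (g a))` for every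
automorphism `α` of `Δ`. This has two consequences. First, choosing `α` so that `α (g a)` lies in a
finite set meeting every orbit of tuples of `Δ`, one sees that only finitely many types are realized
in `Γ`. Each of them is then isolated from the others by a formula, and a back-and-forth
construction shows that tuples of the same type are conjugate under `Aut Γ`. Second, `a` and `b`
have the same type as soon as `g a` and `g b` are conjugate under `Aut Δ`. Hence the injective map
`S ↦ g '' S` sends `n`-subsets from distinct orbits to `n`-subsets from distinct orbits.
-/

open FirstOrder.Language

section Types

variable {L : FirstOrder.Language.{u, v}} {M N : Type*} [L.Structure M] [L.Structure N]
  {ι κ : Type*}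

variable (L) in
/-- The complete type of a tuple: the set of all formulas that it satisfies. Unlike Mathlib's
`Theory.typeOf`, it makes sense in empty structures and does not refer to a theory. -/
def tupleType (a : ι → M) : Set (L.Formula ι) :=
  {φ | φ.Realize a}

@[simp]
theorem mem_tupleType {a : ι → M} {φ : L.Formula ι} : φ ∈ tupleType L a ↔ φ.Realize a :=
  Iff.rfl

theorem tupleType_comp_eq_of_tupleType_eq {a : ι → M} {b : ι → N}
    (hab : tupleType L a = tupleType L b) (f : κ → ι) :
    tupleType L (a ∘ f) = tupleType L (b ∘ f) := by
  ext φ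
  simpa only [mem_tupleType, Formula.realize_relabel] using Set.ext_iff.1 hab (φ.relabel f)

theorem tupleType_eq_of_subset {a : ι → M} {b : ι → N} (hab : tupleType L a ⊆ tupleType L b) :
    tupleType L a = tupleType L b := by
  refine hab.antisymm fun φ hb => ?_
  by_contra ha
  exact hab (show φ.not ∈ tupleType L a from ha) hb

variable (L M) in
/-- The structure `M` realizes only finitely many complete types of `ι`-tuples, for each finite
index type `ι`. -/
def RealizesFinitelyManyTypes : Prop :=
  ∀ (ι : Type) [Finite ι], (Set.range (tupleType L : (ι → M) → Set (L.Formula ι))).Finite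

theorem exists_isolating_formula
    (hfin : (Set.range (tupleType L : (ι → N) → Set (L.Formula ι))).Finite) (a : ι → M) :
    ∃ φ : L.Formula ι, φ.Realize a ∧
      ∀ b : ι → N, φ.Realize b → tupleType L a = tupleType L b := by
  have separating : ∀ t : Set.range (tupleType L : (ι → N) → Set (L.Formula ι)),
      ∃ ψ : L.Formula ι, ψ.Realize a ∧ (ψ ∈ t.1 → tupleType L a = t.1) := by
    rintro ⟨_, b, rfl⟩
    by_cases hab : tupleType L a ⊆ tupleType L b
    · exact ⟨⊤, Formula.realize_top.2 trivial, fun _ => tupleType_eq_of_subset hab⟩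
    · obtain ⟨ψ, ha, hb⟩ := Set.not_subset.1 hab
      exact ⟨ψ, ha, fun hψ => absurd hψ hb⟩
  choose ψ realize_a eq_of_mem using separating
  have := hfin.to_subtype
  exact ⟨Formula.iInf ψ, Formula.realize_iInf.2 realize_a, fun b hb =>
    eq_of_mem ⟨_, b, rfl⟩ (Formula.realize_iInf.1 hb _)⟩

theorem exists_tupleType_sumElim_eq
    (hfin : (Set.range (tupleType L : (ι ⊕ Unit → N) → Set (L.Formula (ι ⊕ Unit)))).Finite)
    {a : ι → M} {b : ι → N} (hab : tupleType L a = tupleType L b) (c : M) :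
    ∃ d : N, tupleType L (Sum.elim a fun _ : Unit => c) =
      tupleType L (Sum.elim b fun _ : Unit => d) := by
  obtain ⟨φ, hφ, isolates⟩ := exists_isolating_formula hfin (Sum.elim a fun _ : Unit => c)
  have exists_c : φ.iExs Unit ∈ tupleType L a := Formula.realize_iExs.2 ⟨_, hφ⟩
  rw [hab] at exists_c
  obtain ⟨d, hd⟩ := Formula.realize_iExs.1 exists_c
  exact ⟨d (), isolates _ hd⟩

end Types

section BackAndForth

variable {L : FirstOrder.Language.{u, v}} {M N : Type*} [L.Structure M] [L.Structure N]

variable (L) in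
/-- A relation between two structures is elementary if any two tuples related coordinatewise have
the same complete type. These are the graphs of partial elementary maps; encoding them as relations
makes the two directions of a back-and-forth argument symmetric. -/
def IsElementaryRel (s : Set (M × N)) : Prop :=
  ∀ ⦃k : ℕ⦄ (x : Fin k → M × N), (∀ i, x i ∈ s) →
    tupleType L (Prod.fst ∘ x) = tupleType L (Prod.snd ∘ x)

theorem isElementaryRel_range {ι : Type*} {a : ι → M} {b : ι → N}
    (hab : tupleType L a = tupleType L b) :
    IsElementaryRel L (Set.range fun i => (a i, b i)) := by
  intro k x hx
  choose f hf using hx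
  obtain rfl : (fun i => (a (f i), b (f i))) = x := funext hf
  exact tupleType_comp_eq_of_tupleType_eq hab f

namespace IsElementaryRel

variable {s : Set (M × N)}

theorem swap (hs : IsElementaryRel L s) : IsElementaryRel L (Prod.swap ⁻¹' s) :=
  fun _ x hx => (hs (Prod.swap ∘ x) hx).symm

theorem sUnion {S : Set (Set (M × N))} (hne : S.Nonempty) (hdir : DirectedOn (· ⊆ ·) S)
    (hS : ∀ s ∈ S, IsElementaryRel L s) : IsElementaryRel L (⋃₀ S) := by
  intro k x hx
  obtain ⟨s, hs, hxs⟩ := hdir.exists_mem_subset_of_finite_of_subset_sUnion hne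
    (Set.finite_range x) (Set.range_subset_iff.2 hx)
  exact hS s hs x (Set.range_subset_iff.1 hxs)

theorem fst_eq_iff_snd_eq (hs : IsElementaryRel L s) {p q : M × N} (hp : p ∈ s) (hq : q ∈ s) :
    p.1 = q.1 ↔ p.2 = q.2 := by
  have same_type := hs ![p, q] (Fin.forall_fin_two.2 ⟨hp, hq⟩)
  simpa [Formula.realize_equal] using
    Set.ext_iff.1 same_type ((Term.var 0).equal (Term.var 1))

theorem exists_extension_left (hN : RealizesFinitelyManyTypes L N) (hs : IsElementaryRel L s)
    (hfin : s.Finite) (c : M) :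
    ∃ t, s ⊆ t ∧ IsElementaryRel L t ∧ t.Finite ∧ ∃ d, (c, d) ∈ t := by
  obtain ⟨k, x, -, rfl⟩ := hfin.fin_param
  obtain ⟨d, hd⟩ := exists_tupleType_sumElim_eq (hN _) (hs x Set.mem_range_self) c
  refine ⟨_, ?_, isElementaryRel_range hd, Set.finite_range _, d, Sum.inr (), rfl⟩
  rintro _ ⟨i, rfl⟩
  exact ⟨Sum.inl i, rfl⟩

theorem exists_extension_right (hM : RealizesFinitelyManyTypes L M) (hs : IsElementaryRel L s)
    (hfin : s.Finite) (d : N) :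
    ∃ t, s ⊆ t ∧ IsElementaryRel L t ∧ t.Finite ∧ ∃ c, (c, d) ∈ t := by
  obtain ⟨t, hst, ht, htfin, c, hc⟩ := hs.swap.exists_extension_left hM
    (hfin.preimage Prod.swap_injective.injOn) d
  exact ⟨Prod.swap ⁻¹' t, fun _ hp => hst hp, ht.swap,
    htfin.preimage Prod.swap_injective.injOn, c, hc⟩

theorem exists_total_extension [Countable M] [Countable N]
    (hM : RealizesFinitelyManyTypes L M) (hN : RealizesFinitelyManyTypes L N)
    (hs : IsElementaryRel L s) (hfin : s.Finite) :
    ∃ t, s ⊆ t ∧ IsElementaryRel L t ∧ (∀ c, ∃ d, (c, d) ∈ t) ∧ ∀ d, ∃ c, (c, d) ∈ t := by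
  obtain ⟨_⟩ := nonempty_encodable (M ⊕ N)
  let FiniteElementaryRel := {t : Set (M × N) // IsElementaryRel L t ∧ t.Finite}
  let cover : M ⊕ N → Order.Cofinal FiniteElementaryRel := Sum.elim
    (fun c => ⟨{t | ∃ d, (c, d) ∈ t.1}, fun t => by
      obtain ⟨t', htt', ht', hfin', hc⟩ := t.2.1.exists_extension_left hN t.2.2 c
      exact ⟨⟨t', ht', hfin'⟩, hc, htt'⟩⟩)
    (fun d => ⟨{t | ∃ c, (c, d) ∈ t.1}, fun t => by
      obtain ⟨t', htt', ht', hfin', hd⟩ := t.2.1.exists_extension_right hM t.2.2 d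
      exact ⟨⟨t', ht', hfin'⟩, hd, htt'⟩⟩)
  let start : FiniteElementaryRel := ⟨s, hs, hfin⟩
  let generic := Order.idealOfCofinals start cover
  have start_mem : start ∈ generic := Order.mem_idealOfCofinals start cover
  refine ⟨⋃₀ (Subtype.val '' (generic : Set FiniteElementaryRel)),
    Set.subset_sUnion_of_mem ⟨start, start_mem, rfl⟩,
    .sUnion ⟨s, start, start_mem, rfl⟩ (directedOn_image.2 generic.directed) ?_,
    fun c => ?_, fun d => ?_⟩
  · rintro _ ⟨t, -, rfl⟩
    exact t.2.1
  · obtain ⟨t, ⟨d, hd⟩, ht⟩ := Order.cofinal_meets_idealOfCofinals start cover (.inl c)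
    exact ⟨d, t.1, ⟨t, ht, rfl⟩, hd⟩
  · obtain ⟨t, ⟨c, hc⟩, ht⟩ := Order.cofinal_meets_idealOfCofinals start cover (.inr d)
    exact ⟨c, t.1, ⟨t, ht, rfl⟩, hc⟩

theorem exists_elementaryEmbedding (hs : IsElementaryRel L s) (total : ∀ c, ∃ d, (c, d) ∈ s) :
    ∃ e : M ↪ₑ[L] N, ∀ c, (c, e c) ∈ s := by
  choose f hf using total
  exact ⟨⟨f, fun _ φ x => (Set.ext_iff.1 (hs (fun i => (x i, f (x i))) fun i => hf (x i)) φ).symm⟩,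
    hf⟩

end IsElementaryRel

theorem exists_equiv_of_surjective (e : M ↪[L] N) (he : Function.Surjective e) :
    ∃ β : M ≃[L] N, ⇑β = e :=
  ⟨{ Equiv.ofBijective e ⟨e.injective, he⟩ with
      map_fun' := e.map_fun
      map_rel' := e.map_rel }, rfl⟩

theorem exists_equiv_of_tupleType_eq [Countable M] [Countable N]
    (hM : RealizesFinitelyManyTypes L M) (hN : RealizesFinitelyManyTypes L N)
    {ι : Type*} [Finite ι] {a : ι → M} {b : ι → N} (hab : tupleType L a = tupleType L b) :
    ∃ β : M ≃[L] N, β ∘ a = b := by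
  obtain ⟨t, hst, ht, total_left, total_right⟩ :=
    (isElementaryRel_range hab).exists_total_extension hM hN (Set.finite_range _)
  obtain ⟨e, he⟩ := ht.exists_elementaryEmbedding total_left
  have apply_eq {c : M} {d : N} (hcd : (c, d) ∈ t) : e c = d :=
    (ht.fst_eq_iff_snd_eq (he c) hcd).1 rfl
  obtain ⟨β, hβ⟩ := exists_equiv_of_surjective e.toEmbedding fun d =>
    (total_right d).imp fun _ hcd => apply_eq hcd
  refine ⟨β, funext fun i => ?_⟩
  rw [hβ]
  exact apply_eq (hst ⟨i, rfl⟩)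

end BackAndForth

section Orbits

variable {L : FirstOrder.Language.{u, v}} {M N : Type*} [L.Structure M] [L.Structure N]

theorem mem_subsetOrbit_self (S : Set M) : S ∈ subsetOrbit L M S :=
  ⟨FirstOrder.Language.Equiv.refl L M, by simp⟩

theorem mem_subsetOrbit_symm {S T : Set M} (hT : T ∈ subsetOrbit L M S) :
    S ∈ subsetOrbit L M T := by
  obtain ⟨α, rfl⟩ := hT
  exact ⟨α.symm, by simp [Set.image_image]⟩

theorem subsetOrbit_subset_of_mem {S T : Set M} (hT : T ∈ subsetOrbit L M S) :
    subsetOrbit L M T ⊆ subsetOrbit L M S := by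
  obtain ⟨α, rfl⟩ := hT
  rintro _ ⟨β, rfl⟩
  exact ⟨β.comp α, by simp [Set.image_image]⟩

theorem subsetOrbit_eq_iff {S T : Set M} :
    subsetOrbit L M S = subsetOrbit L M T ↔ T ∈ subsetOrbit L M S :=
  ⟨fun h => h ▸ mem_subsetOrbit_self T, fun hT =>
    (subsetOrbit_subset_of_mem (mem_subsetOrbit_symm hT)).antisymm (subsetOrbit_subset_of_mem hT)⟩

theorem nSubsetOrbits_eq_image (n : ℕ) :
    nSubsetOrbits L M n = subsetOrbit L M '' {S | S.encard = n} := by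
  ext O
  simp only [nSubsetOrbits, Set.mem_image, Set.mem_ofPred_eq, eq_comm]

theorem encard_nSubsetOrbits_le_of_injective {g : M → N} (hg : Function.Injective g) {n : ℕ}
    (reflects : ∀ S T : Set M, S.encard = n → T.encard = n →
      g '' T ∈ subsetOrbit L N (g '' S) → T ∈ subsetOrbit L M S) :
    (nSubsetOrbits L M n).encard ≤ (nSubsetOrbits L N n).encard := by
  obtain ⟨reps, hreps, bij⟩ := Set.exists_subset_bijOn {S : Set M | S.encard = n} (subsetOrbit L M)
  rw [nSubsetOrbits_eq_image, ← bij.image_eq, bij.injOn.encard_image]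
  refine Set.encard_le_encard_of_injOn (f := fun S => subsetOrbit L N (g '' S))
    (fun S hS => ⟨g '' S, (hg.encard_image S).trans (hreps hS), rfl⟩) fun S hS T hT heq => ?_
  exact bij.injOn hS hT (subsetOrbit_eq_iff.2
    (reflects S T (hreps hS) (hreps hT) (subsetOrbit_eq_iff.1 heq)))

theorem exists_finite_image_subset_of_finite_nSubsetOrbits {n : ℕ}
    (hfin : (nSubsetOrbits L M n).Finite) :
    ∃ F : Set M, F.Finite ∧ ∀ S : Set M, S.encard = n → ∃ α : M ≃[L] M, α '' S ⊆ F := by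
  obtain ⟨reps, hreps, bij⟩ := Set.exists_subset_bijOn {S : Set M | S.encard = n} (subsetOrbit L M)
  rw [← nSubsetOrbits_eq_image] at bij
  refine ⟨⋃₀ reps, (bij.finite_iff_finite.2 hfin).sUnion fun S hS =>
    Set.finite_of_encard_eq_coe (hreps hS), fun S hS => ?_⟩
  obtain ⟨T, hT, heq⟩ := bij.surjOn ⟨S, hS, rfl⟩
  obtain ⟨α, rfl⟩ := subsetOrbit_eq_iff.1 heq.symm
  exact ⟨α, Set.subset_sUnion_of_mem hT⟩

theorem exists_finite_forall_exists_apply_mem (hfin : ∀ n, (nSubsetOrbits L M n).Finite)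
    (ι : Type*) [Finite ι] :
    ∃ F : Set M, F.Finite ∧ ∀ a : ι → M, ∃ α : M ≃[L] M, ∀ i, α (a i) ∈ F := by
  choose F hF absorbs using fun n => exists_finite_image_subset_of_finite_nSubsetOrbits (hfin n)
  refine ⟨⋃ n ∈ Set.Iic (Nat.card ι), F n,
    (Set.finite_Iic _).biUnion fun n _ => hF n, fun a => ?_⟩
  have card_le : (Set.range a).ncard ≤ Nat.card ι := by
    rw [← Nat.card_coe_set_eq]
    exact Finite.card_range_le a
  obtain ⟨α, hα⟩ := absorbs _ (Set.range a) (Set.finite_range a).cast_ncard_eq.symm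
  exact ⟨α, fun i => Set.mem_biUnion card_le (hα ⟨a i, ⟨i, rfl⟩, rfl⟩)⟩

end Orbits

section ModelCompleteCore

variable {L : FirstOrder.Language.{u, v}} {Γ Δ : Type*} [L.Structure Γ] [L.Structure Δ]

theorem IsCoreStructure.exists_elementaryEmbedding (hcore : IsCoreStructure L Γ)
    (hmc : IsModelCompleteStructure L Γ) (f : Γ →[L] Γ) : ∃ e : Γ ↪ₑ[L] Γ, ⇑e = f := by
  obtain ⟨e, he⟩ := hcore f
  refine ⟨⟨e, fun n φ x => ⟨fun hφ => ?_, hmc e n φ x⟩⟩, funext he⟩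
  by_contra hnot
  exact hmc e n φ.not x hnot hφ

theorem tupleType_endomorphism_comp (hcore : IsCoreStructure L Γ)
    (hmc : IsModelCompleteStructure L Γ) (f : Γ →[L] Γ) {ι : Type*} (a : ι → Γ) :
    tupleType L (f ∘ a) = tupleType L a := by
  obtain ⟨e, he⟩ := hcore.exists_elementaryEmbedding hmc f
  rw [← he]
  exact Set.ext fun φ => e.map_formula φ a

theorem realizesFinitelyManyTypes_of_homs (hΔ : ∀ n, (nSubsetOrbits L Δ n).Finite)
    (hcore : IsCoreStructure L Γ) (hmc : IsModelCompleteStructure L Γ)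
    (g : Γ →[L] Δ) (h : Δ →[L] Γ) : RealizesFinitelyManyTypes L Γ := by
  intro ι _
  obtain ⟨F, hF, absorbs⟩ := exists_finite_forall_exists_apply_mem hΔ ι
  have finite_tuples : {y : ι → Δ | ∀ i, y i ∈ F}.Finite := Set.Finite.pi' fun _ => hF
  refine (finite_tuples.image fun y => tupleType L (h ∘ y)).subset ?_
  rintro _ ⟨a, rfl⟩
  obtain ⟨α, hα⟩ := absorbs (g ∘ a)
  exact ⟨α ∘ g ∘ a, hα, tupleType_endomorphism_comp hcore hmc (h.comp (α.toHom.comp g)) a⟩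

theorem tupleType_eq_of_conjugate_images (hcore : IsCoreStructure L Γ)
    (hmc : IsModelCompleteStructure L Γ) (g : Γ →[L] Δ) (h : Δ →[L] Γ) (α : Δ ≃[L] Δ)
    {ι : Type*} {a b : ι → Γ} (hab : α ∘ g ∘ a = g ∘ b) : tupleType L a = tupleType L b :=
  calc tupleType L a
    _ = tupleType L (h ∘ α ∘ g ∘ a) :=
      (tupleType_endomorphism_comp hcore hmc (h.comp (α.toHom.comp g)) a).symm
    _ = tupleType L (h ∘ g ∘ b) := by rw [hab]
    _ = tupleType L b := tupleType_endomorphism_comp hcore hmc (h.comp g) b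

theorem IsCoreStructure.injective_hom (hcore : IsCoreStructure L Γ) (g : Γ →[L] Δ)
    (h : Δ →[L] Γ) : Function.Injective g := by
  obtain ⟨e, he⟩ := hcore (h.comp g)
  have comp_injective : Function.Injective (h ∘ g) := (funext he : ⇑e = h ∘ g) ▸ e.injective
  exact comp_injective.of_comp

theorem mem_subsetOrbit_of_image_mem_subsetOrbit [Countable Γ]
    (hΔ : ∀ n, (nSubsetOrbits L Δ n).Finite) (hcore : IsCoreStructure L Γ)
    (hmc : IsModelCompleteStructure L Γ) (g : Γ →[L] Δ) (h : Δ →[L] Γ)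
    {S T : Set Γ} (hS : S.Finite) (hST : g '' T ∈ subsetOrbit L Δ (g '' S)) :
    T ∈ subsetOrbit L Γ S := by
  obtain ⟨α, hα⟩ := hST
  have exists_preimage (x : S) : ∃ y, g y = α (g x) := by
    obtain ⟨y, -, hy⟩ := hα.ge ⟨g x, ⟨x, x.2, rfl⟩, rfl⟩
    exact ⟨y, hy⟩
  choose b hb using exists_preimage
  have range_b : Set.range b = T := (hcore.injective_hom g h).image_injective <| by
    rw [hα, ← Set.range_comp, Set.image_image, Set.image_eq_range]
    exact congrArg Set.range (funext hb)
  have := hS.to_subtype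
  have hΓ := realizesFinitelyManyTypes_of_homs hΔ hcore hmc g h
  obtain ⟨β, hβ⟩ := exists_equiv_of_tupleType_eq hΓ hΓ <|
    tupleType_eq_of_conjugate_images hcore hmc g h α (a := Subtype.val) (funext hb).symm
  exact ⟨β, by rw [← range_b, ← hβ, Set.range_comp, Subtype.range_val]⟩

end ModelCompleteCore

theorem mainTheorem12_general {L : FirstOrder.Language.{u, v}} {Δ : Type*} {Γ : Type*}
    [L.Structure Δ] [L.Structure Γ] (hΔ : ∀ k, (nSubsetOrbits L Δ k).Finite)
    (hΓ : IsModelCompleteCoreOf L Γ Δ) (n : ℕ) :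
    (nSubsetOrbits L Γ n).encard ≤ (nSubsetOrbits L Δ n).encard := by
  obtain ⟨_, hcore, hmc, ⟨g⟩, ⟨h⟩⟩ := hΓ
  exact encard_nSubsetOrbits_le_of_injective (hcore.injective_hom g h) fun _ _ hS _ =>
    mem_subsetOrbit_of_image_mem_subsetOrbit hΔ hcore hmc g h (Set.finite_of_encard_eq_coe hS)

theorem mainTheorem12 {L : FirstOrder.Language.{u, v}} [L.IsRelational]
    {Δ : Type*} {Γ : Type*} [L.Structure Δ] [L.Structure Γ]
    (hΔ : IsOmegaCategorical L Δ) (hΓ : IsModelCompleteCoreOf L Γ Δ) (n : ℕ) :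
    (nSubsetOrbits L Γ n).encard ≤ (nSubsetOrbits L Δ n).encard :=
  mainTheorem12_general hΔ.2 hΓ n
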